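/- Let $k$ be an algebraically closed field of characteristic zero and let $X$ be a normal projective variety over $k$ (integral, separated, of finite type) which is $\mathbb{Q}$-factorial, i.e. every Weil divisor on $X$ has a positive multiple that is Cartier. Suppose that the Cartier class group $\operatorname{CaCl}(X)$ (Cartier divisors modulo principal ones) is isomorphic to $\mathbb{Z}$. Let $H$ be any ample $\mathbb{Q}$-divisor on $X$, i.e. a $\mathbb{Q}$-divisor such that $mH$ is a very ample Cartier divisor for some integer $m \geq 1$. Then every cylinder $U$ in $X$, i.e. every non-empty open subset $U \subseteq X$ that is isomorphic over $k$ to $C \times_k \mathbb{A}^1_k$ for some affine $k$-scheme $C$, is $H$-polar: there is an effective $\mathbb{Q}$-Cartier $\mathbb{Q}$-divisor $D$ on $X$ such that $D \sim_{\mathbb{Q}} H$ (that is, $nD - nH$ is the divisor of a nonzero rational function for some integer $n \geq 1$) and $U = X \setminus \operatorname{Supp}(D)$. -/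

import Mathlib

open CategoryTheory CategoryTheory.Limits AlgebraicGeometry TopologicalSpace

universe u

noncomputable section

namespace PolarCyl

/-! ### Projective space and varieties -/

section ProjectiveSpace

attribute [local instance] MvPolynomial.gradedAlgebra

variable (k : Type u) [Field k] (n : ℕ)

/-- Projective `n`-space over `k`, as `Proj` of the standard graded ring `k[x_0, …, x_n]`. -/
def ProjSpace : Scheme.{u} :=
  Proj (MvPolynomial.homogeneousSubmodule (Fin (n + 1)) k)

/-- The structure morphism of projective space. -/
def ProjSpace.hom : ProjSpace k n ⟶ Spec (CommRingCat.of k) :=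
  Proj.toSpecZero (MvPolynomial.homogeneousSubmodule (Fin (n + 1)) k) ≫
    Spec.map (CommRingCat.ofHom
      (algebraMap k (MvPolynomial.homogeneousSubmodule (Fin (n + 1)) k 0)))

/-- The standard affine open `D_+(x_b)` of projective space. -/
def ProjSpace.chart (b : Fin (n + 1)) : (ProjSpace k n).Opens :=
  Proj.basicOpen (MvPolynomial.homogeneousSubmodule (Fin (n + 1)) k) (MvPolynomial.X b)

/-- The regular function `x_a / x_b` on `D_+(x_b)`. -/
def ProjSpace.ratio (a b : Fin (n + 1)) : Γ(ProjSpace k n, ProjSpace.chart k n b) :=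
  (Proj.awayToSection (MvPolynomial.homogeneousSubmodule (Fin (n + 1)) k)
    (MvPolynomial.X b)).hom
    (HomogeneousLocalization.Away.mk (MvPolynomial.homogeneousSubmodule (Fin (n + 1)) k)
      (d := 1) (MvPolynomial.isHomogeneous_X k b) 1 (MvPolynomial.X a)
      (MvPolynomial.isHomogeneous_X k a))

end ProjectiveSpace

/-- A variety over `k`: an integral separated scheme of finite type over `k`. -/
structure Variety (k : Type u) [Field k] where
  /-- The underlying scheme. -/
  X : Scheme.{u}
  /-- The structure morphism. -/
  hom : X ⟶ Spec (CommRingCat.of k)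
  integral : IsIntegral X
  separated : IsSeparated hom
  locallyOfFiniteType : LocallyOfFiniteType hom
  quasiCompact : QuasiCompact hom

namespace Variety

attribute [instance] Variety.integral Variety.separated Variety.locallyOfFiniteType
  Variety.quasiCompact

variable {k : Type u} [Field k] (V : Variety k)

instance : IsLocallyNoetherian V.X := LocallyOfFiniteType.isLocallyNoetherian V.hom

/-- The function field `K(X)`. -/
abbrev K : Type u := V.X.functionField

/-- `X` is normal: all its local rings are integrally closed (in their fraction fields). -/
def IsNormal : Prop := ∀ x : V.X, IsIntegrallyClosed (V.X.presheaf.stalk x)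

/-- `X` is projective: it admits a closed immersion over `k` into some projective space. -/
def IsProjective : Prop :=
  ∃ (n : ℕ) (i : V.X ⟶ ProjSpace k n), IsClosedImmersion i ∧ i ≫ ProjSpace.hom k n = V.hom

/-! ### Weil divisors and `ℚ`-divisors -/

/-- Prime divisors, each given by its generic point: a point of codimension one
(the order on the points is that of specialization, with the generic point on top). -/
def PrimeDivisor : Type u := {x : V.X // Order.coheight x = 1}

/-- The closed subset of `X` that a prime divisor is. -/
def PrimeDivisor.locus {V : Variety k} (P : V.PrimeDivisor) : Set V.X := closure {P.1}

/-- The group `Div(X)` of Weil divisors. -/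
abbrev Div : Type u := V.PrimeDivisor →₀ ℤ

/-- The group `Div(X, ℚ) = Div(X) ⊗ ℚ` of `ℚ`-divisors. -/
abbrev QDiv : Type u := V.PrimeDivisor →₀ ℚ

variable {V}

/-- An integral divisor viewed as a `ℚ`-divisor. -/
def Div.toQDiv (D : V.Div) : V.QDiv := D.mapRange (fun m : ℤ => (m : ℚ)) Int.cast_zero

/-- The order of vanishing of a rational function along a prime divisor. -/
def ordAlong (P : V.PrimeDivisor) (f : V.K) : ℤ := Scheme.ord f P.1

/-- `D` is the divisor of a nonzero rational function. -/
def QDiv.IsPrincipal (D : V.QDiv) : Prop :=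
  ∃ f : V.Kˣ, ∀ P : V.PrimeDivisor, D P = (ordAlong P (f : V.K) : ℚ)

/-- `ℚ`-linear equivalence: `nD - nD'` is principal for some positive integer `n`. -/
def QDiv.QLinEquiv (D D' : V.QDiv) : Prop :=
  ∃ n : ℕ, 0 < n ∧ QDiv.IsPrincipal (n • D - n • D')

/-- All coefficients are nonnegative. -/
def QDiv.IsEffective (D : V.QDiv) : Prop := ∀ P : V.PrimeDivisor, 0 ≤ D P

/-- The union of the prime divisors that occur with nonzero coefficient. -/
def QDiv.supp (D : V.QDiv) : Set V.X := ⋃ P ∈ {P : V.PrimeDivisor | D P ≠ 0}, P.locus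

/-! ### Cartier divisors -/

variable (V) in
/-- The subgroup `𝒪_{X,x}^*` of `K(X)^*`. -/
def stalkUnits (x : V.X) : Subgroup V.Kˣ :=
  (Units.map (algebraMap (V.X.presheaf.stalk x) V.X.functionField).toMonoidHom).range

variable (V) in
/-- The group `CaDiv(X)` of Cartier divisors, i.e. of global sections of `𝒦^*/𝒪^*`. As `X` is
integral, `𝒦` is the constant sheaf `K(X)`, the stalk of `𝒦^*/𝒪^*` at `x` is `K(X)^*/𝒪_{X,x}^*`,
and a section is a family of elements of the stalks that is induced locally, around every point,
by a single rational function. The group is written multiplicatively. -/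
def CaDiv : Subgroup (∀ x : V.X, V.Kˣ ⧸ V.stalkUnits x) where
  carrier := {s | ∀ x : V.X, ∃ W : V.X.Opens, x ∈ W ∧
    ∃ f : V.Kˣ, ∀ y ∈ W, s y = (f : V.Kˣ ⧸ V.stalkUnits y)}
  mul_mem' := by
    intro s t hs ht x
    obtain ⟨W, hxW, f, hf⟩ := hs x
    obtain ⟨W', hxW', g, hg⟩ := ht x
    refine ⟨W ⊓ W', ⟨hxW, hxW'⟩, f * g, fun y hy => ?_⟩
    rw [Pi.mul_apply, hf y hy.1, hg y hy.2, QuotientGroup.mk_mul]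
  one_mem' := fun x => ⟨⊤, trivial, 1, fun y _ => rfl⟩
  inv_mem' := by
    intro s hs x
    obtain ⟨W, hxW, f, hf⟩ := hs x
    refine ⟨W, hxW, f⁻¹, fun y hy => ?_⟩
    rw [Pi.inv_apply, hf y hy, QuotientGroup.mk_inv]

variable (V) in
/-- The Cartier divisor of a nonzero rational function. -/
def principalCartier : V.Kˣ →* V.CaDiv where
  toFun f := ⟨fun _ => f, fun _ => ⟨⊤, trivial, f, fun _ _ => rfl⟩⟩
  map_one' := rfl
  map_mul' _ _ := rfl

instance : (principalCartier V).range.Normal where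
  conj_mem E hE F := by
    have h : F * E * F⁻¹ = E := by
      refine Subtype.ext (funext fun x => ?_)
      exact mul_inv_cancel_comm (F.1 x) (E.1 x)
    rwa [h]

variable (V) in
/-- The Cartier class group `CaCl(X)`, written multiplicatively. -/
abbrev CaCl : Type u := V.CaDiv ⧸ (principalCartier V).range

/-- The order along a prime divisor as a homomorphism on `K(X)^*`. -/
def ordHom (P : V.PrimeDivisor) : V.Kˣ →* Multiplicative ℤ where
  toFun f := Multiplicative.ofAdd (ordAlong P (f : V.K))
  map_one' := by
    have h := Scheme.ord_mul (x := P.1) (one_ne_zero (α := V.X.functionField)) one_ne_zero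
    rw [mul_one] at h
    have h' : Scheme.ord (1 : V.X.functionField) P.1 = 0 := by linarith
    simp [ordAlong, h']
  map_mul' f g := by
    simp only [ordAlong, Units.val_mul, Scheme.ord_mul f.ne_zero g.ne_zero, ofAdd_add]

theorem stalkUnits_le_ker_ordHom (P : V.PrimeDivisor) :
    V.stalkUnits P.1 ≤ (ordHom P).ker := by
  rintro _ ⟨a, rfl⟩
  have : Ring.KrullDimLE 1 (V.X.presheaf.stalk P.1) := krullDimLE_of_coheight_le P.2.le
  have h : Scheme.ordHom P.1 P.2
      (algebraMap (V.X.presheaf.stalk P.1) V.X.functionField a) = 1 :=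
    Ring.ordFrac_of_isUnit a.isUnit
  have h0 : algebraMap (V.X.presheaf.stalk P.1) V.X.functionField a ≠ 0 := by
    intro h1
    rw [h1, map_zero] at h
    exact zero_ne_one h
  have : Scheme.ord (algebraMap (V.X.presheaf.stalk P.1) V.X.functionField a) P.1 = 0 :=
    (Scheme.ord_eq_iff P.2 h0).2 h
  rw [MonoidHom.mem_ker]
  exact congrArg Multiplicative.ofAdd this

/-- The multiplicity of a Cartier divisor along a prime divisor: the order of a local equation. -/
def CaDiv.mult (E : V.CaDiv) (P : V.PrimeDivisor) : ℤ :=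
  Multiplicative.toAdd
    (QuotientGroup.lift (V.stalkUnits P.1) (ordHom P) (stalkUnits_le_ker_ordHom P) (E.1 P.1))

/-- `D` is (integral and) the Weil divisor of a Cartier divisor. -/
def QDiv.IsCartier (D : V.QDiv) : Prop :=
  ∃ E : V.CaDiv, ∀ P : V.PrimeDivisor, D P = (CaDiv.mult E P : ℚ)

/-- Some positive multiple of `D` is a Cartier divisor. -/
def QDiv.IsQCartier (D : V.QDiv) : Prop := ∃ n : ℕ, 0 < n ∧ QDiv.IsCartier (n • D)

variable (V) in
/-- Every integral Weil divisor is `ℚ`-Cartier. -/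
def IsQFactorial : Prop := ∀ D : V.Div, QDiv.IsQCartier (Div.toQDiv D)

/-! ### The sheaf of a divisor and ampleness -/

/-- The sections of `𝒪_X(D)` over an open set `W`, as rational functions: `0` and the `f` with
`div f + D ≥ 0` on `W`. -/
def QDiv.sections (D : V.QDiv) (W : V.X.Opens) : Set V.K :=
  {f | f ≠ 0 → ∀ P : V.PrimeDivisor, P.1 ∈ W → 0 ≤ (ordAlong P f : ℚ) + D P}

/-- The stalk of `𝒪_X(D)` at `x`, inside the function field. -/
def QDiv.stalk (D : V.QDiv) (x : V.X) : Set V.K :=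
  {f | ∃ W : V.X.Opens, x ∈ W ∧ f ∈ QDiv.sections D W}

/-- `s` generates the stalk of `𝒪_X(D)` at `x` over the local ring at `x`. -/
def QDiv.GeneratesAt (D : V.QDiv) (s : V.K) (x : V.X) : Prop :=
  s ∈ QDiv.stalk D x ∧ ∀ g ∈ QDiv.stalk D x, ∃ a : V.X.presheaf.stalk x,
    g = algebraMap (V.X.presheaf.stalk x) V.X.functionField a * s

/-- `i : X ⟶ ℙⁿ` is the morphism `x ↦ [s_0(x) : … : s_n(x)]` given by global sections
`s_0, …, s_n` of `𝒪_X(D)`, i.e. there is an isomorphism `i^* 𝒪(1) ≅ 𝒪_X(D)` that takes each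
`i^* x_a` to `s_a`: the locus where `s_a` generates `𝒪_X(D)` is the preimage of `D_+(x_a)` (so the
sections generate the sheaf), and `x_a / x_b` pulls back to `s_a / s_b`. -/
structure QDiv.IsMorphismOfSections (D : V.QDiv) {n : ℕ} (s : Fin (n + 1) → V.K)
    (i : V.X ⟶ ProjSpace k n) : Prop where
  comp_hom : i ≫ ProjSpace.hom k n = V.hom
  global : ∀ a, s a ∈ QDiv.sections D ⊤
  locus : ∀ (a : Fin (n + 1)) (x : V.X), i x ∈ ProjSpace.chart k n a ↔ QDiv.GeneratesAt D (s a) x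
  ratio : ∀ (a b : Fin (n + 1))
    (h : genericPoint V.X ∈ i ⁻¹ᵁ ProjSpace.chart k n b),
    (V.X.presheaf.germ (i ⁻¹ᵁ ProjSpace.chart k n b) (genericPoint V.X) h).hom
      ((i.app (ProjSpace.chart k n b)).hom (ProjSpace.ratio k n a b)) * s b = s a

/-- `D` is a very ample Cartier divisor: `𝒪_X(D)` is the pullback of `𝒪(1)` under an immersion over
`k` into some projective space. -/
def QDiv.IsVeryAmple (D : V.QDiv) : Prop :=
  QDiv.IsCartier D ∧ ∃ (n : ℕ) (s : Fin (n + 1) → V.K) (i : V.X ⟶ ProjSpace k n),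
    IsImmersion i ∧ QDiv.IsMorphismOfSections D s i

/-- Some positive multiple of `D` is a very ample Cartier divisor. -/
def QDiv.IsAmple (D : V.QDiv) : Prop := ∃ m : ℕ, 0 < m ∧ QDiv.IsVeryAmple (m • D)

/-! ### Cylinders -/

/-- A cylinder in `X`: a non-empty open subset that is isomorphic over `k` to `C ×_k 𝔸¹` for some
affine `k`-scheme `C`. -/
def IsCylinder (U : V.X.Opens) : Prop :=
  (U : Set V.X).Nonempty ∧
  ∃ (C : Scheme.{u}) (g : C ⟶ Spec (CommRingCat.of k)), IsAffine C ∧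
    ∃ e : U.toScheme ≅ pullback g (𝔸(PUnit.{u + 1}; Spec (CommRingCat.of k)) ↘
        Spec (CommRingCat.of k)),
      e.hom ≫ pullback.fst _ _ ≫ g = U.ι ≫ V.hom

/-- The cylinder `U` is `H`-polar: it is the complement of the support of an effective `ℚ`-Cartier
`ℚ`-divisor that is `ℚ`-linearly equivalent to `H`. -/
def IsPolar (H : V.QDiv) (U : V.X.Opens) : Prop :=
  IsCylinder U ∧ ∃ D : V.QDiv, QDiv.IsEffective D ∧ QDiv.IsQCartier D ∧ QDiv.QLinEquiv D H ∧
    (U : Set V.X) = (QDiv.supp D)ᶜ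

end Variety

end PolarCyl

end

/-! A cylinder over an affine base is affine, and the complement of an affine open set in a normal
separated variety has pure codimension one. So $X \setminus U$ is the support of the reduced divisor
$B$ of the finitely many prime divisors outside $U$. By $\mathbb{Q}$-factoriality some $nB$ is a
Cartier divisor $E$; let $A = mH$ be very ample. If the classes $a$ and $e$ of $A$ and $E$ in
$\operatorname{CaCl}(X) \cong \mathbb{Z}$ are nonzero of the same sign, then $|e|A \sim |a|E$, and a
positive multiple of $B$ is $\mathbb{Q}$-linearly equivalent to $H$.

The signs agree (`toAdd_mul_toAdd_pos`) because $A$ and $E$ are both linearly equivalent to nonzero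
effective divisors. Otherwise a nontrivial nonnegative combination of these would be the divisor of
a function without poles, whereas on a normal proper variety such a function has no zeros either.
That the effective divisors are nonzero comes from $X$ not being affine: a proper affine variety is
a point, with trivial class group.

Both the purity of the complement and the statement on poles rest on the algebraic Hartogs lemma
`mem_range_stalk_of_forall_specializes`. -/

namespace PolarCyl

/-! ### Noetherian integrally closed domains -/

section Algebra

variable {R K : Type*} [CommRing R] [IsDomain R] [Field K] [Algebra R K]
  [IsFractionRing R K]

/-- The denominators of an element of the fraction field outside a noetherian integrally closed
domain lie in a common prime ideal of height one. -/
theorem exists_height_eq_one_of_notMem_range [IsNoetherianRing R] [IsIntegrallyClosed R] (f : K)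
    (hf : f ∉ Set.range (algebraMap R K)) :
    ∃ q : Ideal R, q.IsPrime ∧ q.height = 1 ∧
      ∀ r : R, algebraMap R K r * f ∈ Set.range (algebraMap R K) → r ∈ q := by
  let N : Submodule R K := LinearMap.range (Algebra.linearMap R K)
  have hN : ∀ z : K, z ∈ N ↔ z ∈ Set.range (algebraMap R K) := fun z => Iff.rfl
  have hmk : ∀ (r : R) (z : K), r • (N.mkQ z) = 0 ↔
      algebraMap R K r * z ∈ Set.range (algebraMap R K) := by
    intro r z
    rw [← map_smul, Submodule.mkQ_apply, Submodule.Quotient.mk_eq_zero, hN, Algebra.smul_def]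
  have hf0 : N.mkQ f ≠ 0 := by
    rw [Submodule.mkQ_apply, Ne, Submodule.Quotient.mk_eq_zero, hN]
    exact hf
  -- The denominators of `f` form the annihilator of its class in $K/R$, which lies in an associated
  -- prime `q`, itself the annihilator of the class of some `z`.
  obtain ⟨q, hq, hle⟩ := exists_le_isAssociatedPrime_of_isNoetherianRing R (N.mkQ f) hf0
  rw [isAssociatedPrime_iff] at hq
  obtain ⟨hqp, z', hz'⟩ := hq
  obtain ⟨z, rfl⟩ := N.mkQ_surjective z'
  have hqz : ∀ r : R, r ∈ q ↔ algebraMap R K r * z ∈ Set.range (algebraMap R K) := by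
    intro r
    rw [hz', Submodule.mem_colon_singleton, Submodule.mem_bot, hmk]
  have hz : z ∉ Set.range (algebraMap R K) := by
    intro h
    exact hqp.ne_top ((Ideal.eq_top_iff_one _).2 ((hqz 1).2 (by simpa using h)))
  have hinj := IsFractionRing.injective R K
  -- Otherwise $zq \subseteq q$ with `q` finitely generated and nonzero, so `z` would be integral
  -- over `R`, hence in `R`.
  have hex : ∃ a ∈ q, ∃ s ∉ q, algebraMap R K a * z = algebraMap R K s := by
    by_contra! hcon
    have hint : IsIntegral R z := by
      refine isIntegral_of_smul_mem_submodule (A := K) (M := K)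
        (Submodule.map (Algebra.linearMap R K) q) ?_ ((IsNoetherian.noetherian q).map _) z ?_
      · intro hbot
        have hqbot : q = ⊥ := by
          rw [eq_bot_iff]
          intro r hr
          have := Submodule.mem_map_of_mem (f := Algebra.linearMap R K) hr
          rw [hbot, Submodule.mem_bot, Algebra.linearMap_apply] at this
          exact hinj (by simpa using this)
        obtain ⟨a, b, hb, hab⟩ := IsFractionRing.div_surjective (A := R) z
        have hb0 : algebraMap R K b ≠ 0 :=
          IsFractionRing.to_map_ne_zero_of_mem_nonZeroDivisors hb
        have : b ∈ q := (hqz b).2 ⟨a, by rw [← hab]; field_simp⟩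
        rw [hqbot, Ideal.mem_bot] at this
        exact hb0 (by rw [this, map_zero])
      · rintro _ ⟨r, hr, rfl⟩
        obtain ⟨s, hs⟩ := (hqz r).1 hr
        refine ⟨s, ?_, ?_⟩
        · by_contra hsq
          exact hcon r hr s hsq hs.symm
        · rw [Algebra.linearMap_apply, hs, Algebra.linearMap_apply, smul_eq_mul, mul_comm]
    obtain ⟨y, hy⟩ := IsIntegrallyClosed.isIntegral_iff.1 hint
    exact hz ⟨y, hy⟩
  obtain ⟨a, ha, s, hs, has⟩ := hex
  have key : ∀ b ∈ q, ∃ t, s * b = a * t := by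
    intro b hb
    obtain ⟨t, ht⟩ := (hqz b).1 hb
    refine ⟨t, hinj ?_⟩
    rw [map_mul, map_mul, ht, ← has]
    ring
  -- By `key`, $sq \subseteq (a)$ with $s \notin q$, so `q` becomes principal after localization at
  -- `q`; Krull's principal ideal theorem then bounds its height.
  have hmin : q ∈ (Ideal.span {a}).minimalPrimes := by
    refine ⟨⟨hqp, (Ideal.span_singleton_le_iff_mem _).2 ha⟩, ?_⟩
    rintro p ⟨hp, hap⟩ hpq b hb
    obtain ⟨t, ht⟩ := key b hb
    have h1 : s * b ∈ p := by
      rw [ht]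
      exact p.mul_mem_right _ ((Ideal.span_singleton_le_iff_mem _).1 hap)
    exact (hp.mem_or_mem h1).resolve_left fun h => hs (hpq h)
  have hle1 := Ideal.height_le_one_of_isPrincipal_of_mem_minimalPrimes _ q hmin
  have hne0 : q.height ≠ 0 := by
    intro h0
    rw [Ideal.height_eq_zero_iff_eq_bot] at h0
    rw [h0, Ideal.mem_bot] at ha
    apply hs
    have : algebraMap R K s = 0 := by rw [← has, ha, map_zero, zero_mul]
    rw [hinj (this.trans (map_zero _).symm)]
    exact q.zero_mem
  refine ⟨q, hqp, le_antisymm hle1 (Order.one_le_iff_ne_zero.2 hne0), fun r hr => hle ?_⟩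
  rw [Submodule.mem_colon_singleton, Submodule.mem_bot, hmk]
  exact hr

/-- The elements of nonnegative order are those of the discrete valuation ring. -/
theorem mem_range_of_one_le_ordFrac [IsDiscreteValuationRing R] (f : K)
    (h : 1 ≤ Ring.ordFrac R f) : f ∈ Set.range (algebraMap R K) := by
  rw [Ring.ordFrac_eq_valuation_inv] at h
  have h1 : (IsDiscreteValuationRing.maximalIdeal R).valuation K f ≤ 1 := by
    by_contra! hlt
    exact (inv_lt_one_of_one_lt₀ hlt).not_ge h
  exact IsDiscreteValuationRing.exists_lift_of_le_one h1

theorem exists_ringHom_comp_eq {A R K : Type*} [CommRing A] [CommRing R] [CommRing K]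
    [Algebra R K] (g : A →+* K)
    (hinj : Function.Injective (algebraMap R K)) (h : ∀ a, g a ∈ Set.range (algebraMap R K)) :
    ∃ φ : A →+* R, (algebraMap R K).comp φ = g := by
  choose φ hφ using h
  exact ⟨
    { toFun := φ
      map_one' := hinj (by simp only [hφ, map_one])
      map_mul' := fun a b => hinj (by simp only [hφ, map_mul])
      map_zero' := hinj (by simp only [hφ, map_zero])
      map_add' := fun a b => hinj (by simp only [hφ, map_add]) }, RingHom.ext hφ⟩

end Algebra

/-! ### Points of a scheme and primes of a stalk -/

section Stalk

variable {X : Scheme.{u}} [IsIntegral X]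

/-- A prime ideal `q` of the local ring at `x` is a point `y` specializing to `x`, and the local
ring at `y` is the localization at `q`. -/
theorem exists_specializes_of_isPrime (x : X) (q : Ideal (X.presheaf.stalk x)) [hq : q.IsPrime] :
    ∃ y : X, y ⤳ x ∧ Order.coheight y = q.height ∧
      ∀ f : X.functionField, f ∈ Set.range (algebraMap (X.presheaf.stalk y) X.functionField) →
        ∃ r : X.presheaf.stalk x, r ∉ q ∧ algebraMap (X.presheaf.stalk x) X.functionField r * f ∈
          Set.range (algebraMap (X.presheaf.stalk x) X.functionField) := by
  obtain ⟨_, ⟨U, hU, rfl⟩, hxU, -⟩ :=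
    X.isBasis_affineOpens.exists_subset_of_mem_open (Set.mem_univ x) isOpen_univ
  have : Nonempty U := ⟨⟨x, hxU⟩⟩
  let p : PrimeSpectrum Γ(X, U) :=
    ⟨q.comap (X.presheaf.germ U x hxU).hom, inferInstance⟩
  let y : X := X.fromSpecStalk x ⟨q, hq⟩
  have hy : y = hU.fromSpec p := by
    change X.fromSpecStalk x ⟨q, hq⟩ = _
    rw [← hU.fromSpecStalk_eq_fromSpecStalk hxU]
    rfl
  have hyx : y ⤳ x := by
    have : y ∈ Set.range (X.fromSpecStalk x) := ⟨_, rfl⟩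
    rwa [Scheme.range_fromSpecStalk] at this
  have hyU : y ∈ U := hyx.mem_open U.2 hxU
  have hp : hU.primeIdealOf ⟨y, hyU⟩ = p := by
    have := hU.isOpenImmersion_fromSpec
    apply hU.fromSpec.isOpenEmbedding.injective
    rw [hU.fromSpec_primeIdealOf]
    exact hy
  let _ := TopCat.Presheaf.algebra_section_stalk X.presheaf ⟨x, hxU⟩
  let _ := TopCat.Presheaf.algebra_section_stalk X.presheaf ⟨y, hyU⟩
  have hlx : IsLocalization.AtPrime (X.presheaf.stalk x)
    (hU.primeIdealOf ⟨x, hxU⟩).asIdeal := hU.isLocalization_stalk ⟨x, hxU⟩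
  -- In an affine chart, `y` is the contraction `p` of `q`. Fractions at `y` thus have denominators
  -- whose germs at `x` avoid `q`, and localization preserves the height.
  have hly : IsLocalization.AtPrime (X.presheaf.stalk y) p.asIdeal := by
    have := hU.isLocalization_stalk ⟨y, hyU⟩
    rwa [hp] at this
  refine ⟨y, hyx, ?_, ?_⟩
  · have h1 := ringKrullDim_stalk_eq_coheight y
    rw [IsLocalization.AtPrime.ringKrullDim_eq_height p.asIdeal (X.presheaf.stalk y)] at h1
    rw [← WithBot.coe_eq_coe.1 h1]
    exact IsLocalization.height_under (hU.primeIdealOf ⟨x, hxU⟩).asIdeal.primeCompl q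
  · rintro f ⟨g, rfl⟩
    obtain ⟨⟨a, s⟩, has⟩ := IsLocalization.surj p.asIdeal.primeCompl g
    refine ⟨X.presheaf.germ U x hxU s, s.2, X.presheaf.germ U x hxU a, ?_⟩
    have has' : g * X.presheaf.germ U y hyU s = X.presheaf.germ U y hyU a := has
    have := congrArg (algebraMap (X.presheaf.stalk y) X.functionField) has'
    rw [map_mul, Scheme.algebraMap_germ_eq_germToFunctionField,
      Scheme.algebraMap_germ_eq_germToFunctionField] at this
    rw [Scheme.algebraMap_germ_eq_germToFunctionField,
      Scheme.algebraMap_germ_eq_germToFunctionField, ← this, mul_comm]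

/-- A rational function that is regular at every point has a global section inducing it. -/
theorem exists_globalSection (f : X.functionField)
    (hf : ∀ x : X, f ∈ Set.range (algebraMap (X.presheaf.stalk x) X.functionField)) :
    ∃ g : Γ(X, ⊤), X.presheaf.germ ⊤ (genericPoint X) trivial g = f := by
  have hloc : ∀ x : X, ∃ (U : X.Opens) (_ : x ∈ U) (g : Γ(X, U)),
      ∀ h : genericPoint X ∈ U, X.presheaf.germ U (genericPoint X) h g = f := by
    intro x
    obtain ⟨t, ht⟩ := hf x
    obtain ⟨U, hxU, g, hg⟩ := X.presheaf.exists_germ_eq t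
    refine ⟨U, hxU, g, fun h => ?_⟩
    have : Nonempty U := ⟨⟨x, hxU⟩⟩
    rw [← ht, ← hg, Scheme.algebraMap_germ_eq_germToFunctionField]
  choose U hxU g hg using hloc
  have hgen : ∀ x, genericPoint X ∈ U x := fun x =>
    (genericPoint_specializes x).mem_open (U x).2 (hxU x)
  obtain ⟨s, hs, -⟩ := X.sheaf.existsUnique_gluing' U ⊤ (fun x => homOfLE le_top)
    (fun x _ => Opens.mem_iSup.2 ⟨x, hxU x⟩) g (by
      intro x y
      have : Nonempty (U x ⊓ U y : X.Opens) := ⟨⟨_, hgen x, hgen y⟩⟩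
      -- Sections over a non-empty open set of an integral scheme are determined by their rational
      -- functions, here both equal to `f`.
      apply Scheme.germToFunctionField_injective X (U x ⊓ U y)
      change X.presheaf.germ _ _ _ _ = X.presheaf.germ _ _ _ _
      erw [TopCat.Presheaf.germ_res_apply, TopCat.Presheaf.germ_res_apply]
      exact (hg x _).trans (hg y _).symm)
  refine ⟨s, ?_⟩
  have x : X := genericPoint X
  rw [← hg x (hgen x), ← hs x]
  erw [TopCat.Presheaf.germ_res_apply]

/-- Let `U` be an affine open set of a separated scheme. If all regular functions on `U` are
regular at `x`, then `x` is in `U`. -/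
theorem mem_of_forall_regularAt [X.IsSeparated] {U : X.Opens} (hU : IsAffineOpen U) [Nonempty U]
    (x : X) (h : ∀ g : Γ(X, U), X.germToFunctionField U g ∈
      Set.range (algebraMap (X.presheaf.stalk x) X.functionField)) : x ∈ U := by
  have hinj := IsFractionRing.injective (X.presheaf.stalk x) X.functionField
  obtain ⟨φ, hφ⟩ := exists_ringHom_comp_eq (X.germToFunctionField U).hom hinj h
  let Φ : Γ(X, U) ⟶ X.presheaf.stalk x := CommRingCat.ofHom φ
  have hη : genericPoint X ⤳ x := genericPoint_specializes x
  have hηU : genericPoint X ∈ U := (genericPoint_spec X).mem_open_set_iff U.2 |>.2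
    (by simpa using (Set.nonempty_coe_sort.1 ‹Nonempty U›))
  have hΦ : Φ ≫ X.presheaf.stalkSpecializes hη = X.presheaf.germ U (genericPoint X) hηU := by
    ext a
    exact RingHom.congr_fun hφ a
  have hdom : IsDominant (Spec.map (X.presheaf.stalkSpecializes hη)) := by
    refine ⟨?_⟩
    change DenseRange (PrimeSpectrum.comap (algebraMap (X.presheaf.stalk x) X.functionField))
    rw [PrimeSpectrum.denseRange_comap_iff_ker_le_nilRadical,
      (RingHom.injective_iff_ker_eq_bot _).1 hinj]
    exact bot_le
  -- The canonical map from the spectrum of the local ring and the map through `U` given by `Φ`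
  -- agree on the generic point, which is dense; as `X` is separated, they coincide. The closed
  -- point then lands in `U`.
  have heq : X.fromSpecStalk x = Spec.map Φ ≫ hU.fromSpec := by
    refine ext_of_isDominant (Spec.map (X.presheaf.stalkSpecializes hη)) ?_
    rw [← Spec.map_comp_assoc, hΦ, Scheme.SpecMap_stalkSpecializes_fromSpecStalk,
      ← hU.fromSpecStalk_eq_fromSpecStalk hηU]
    rfl
  have hx : x ∈ Set.range (Spec.map Φ ≫ hU.fromSpec) := by
    rw [← heq, Scheme.range_fromSpecStalk]
    exact specializes_rfl
  obtain ⟨z, hz⟩ := hx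
  have hmem : x ∈ Set.range hU.fromSpec := ⟨Spec.map Φ z, hz⟩
  rwa [hU.range_fromSpec] at hmem

end Stalk

namespace Variety

variable {k : Type u} [Field k] {V : Variety k}

/-! ### Normal varieties -/

theorem isDiscreteValuationRing_stalk (hn : V.IsNormal) (P : V.PrimeDivisor) :
    IsDiscreteValuationRing (V.X.presheaf.stalk P.1) := by
  have h1 : Ring.KrullDimLE 1 (V.X.presheaf.stalk P.1) := krullDimLE_of_coheight_le P.2.le
  have hdim : ringKrullDim (V.X.presheaf.stalk P.1) = 1 := by
    rw [ringKrullDim_stalk_eq_coheight, P.2]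
    rfl
  have hnf : ¬ IsField (V.X.presheaf.stalk P.1) := by
    intro h
    rw [ringKrullDim_eq_zero_of_isField h] at hdim
    exact zero_ne_one hdim
  have := hn P.1
  refine ((IsDiscreteValuationRing.TFAE _ hnf).out 0 2).2 ?_
  have : Ring.DimensionLEOne (V.X.presheaf.stalk P.1) :=
    ⟨fun {p} hp hprime => (Ring.krullDimLE_one_iff_of_isPrime_bot.1 h1) p hp hprime⟩
  have : IsDedekindRing (V.X.presheaf.stalk P.1) := { }
  exact { }

theorem mem_range_stalk_of_ordAlong_nonneg (hn : V.IsNormal) (P : V.PrimeDivisor) {f : V.K}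
    (hf : f ≠ 0) (h : 0 ≤ ordAlong P f) :
    f ∈ Set.range (algebraMap (V.X.presheaf.stalk P.1) V.K) := by
  have := isDiscreteValuationRing_stalk hn P
  exact mem_range_of_one_le_ordFrac f ((Scheme.le_ord_iff P.2 hf).1 h)

/-- A rational function on a normal variety that is regular in codimension one near `x` is regular
at `x`. -/
theorem mem_range_stalk_of_forall_specializes (hn : V.IsNormal) (x : V.X) (f : V.K)
    (h : ∀ P : V.PrimeDivisor, P.1 ⤳ x →
      f ∈ Set.range (algebraMap (V.X.presheaf.stalk P.1) V.K)) :
    f ∈ Set.range (algebraMap (V.X.presheaf.stalk x) V.K) := by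
  by_contra hf
  have := hn x
  obtain ⟨q, hq, hq1, hden⟩ := exists_height_eq_one_of_notMem_range f hf
  -- The height-one prime containing all denominators of `f` is a prime divisor through `x`;
  -- regularity of `f` there supplies a denominator outside it.
  obtain ⟨y, hyx, hy1, hloc⟩ := exists_specializes_of_isPrime x q
  obtain ⟨r, hr, hrf⟩ := hloc f (h ⟨y, hy1.trans hq1⟩ hyx)
  exact hr (hden r hrf)

theorem isSeparated (V : Variety k) : V.X.IsSeparated := by
  refine ⟨?_⟩
  rw [← terminal.comp_from V.hom]
  infer_instance

/-- The complement of an affine open subset of a normal variety is of pure codimension one. -/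
theorem exists_primeDivisor_of_notMem (hn : V.IsNormal) {U : V.X.Opens} (hU : IsAffineOpen U)
    (hne : (U : Set V.X).Nonempty) {x : V.X} (hx : x ∉ U) :
    ∃ P : V.PrimeDivisor, P.1 ⤳ x ∧ P.1 ∉ U := by
  by_contra! hcon
  have := V.isSeparated
  have : Nonempty U := hne.to_subtype
  refine hx (mem_of_forall_regularAt hU x fun g => ?_)
  refine mem_range_stalk_of_forall_specializes hn x _ fun P hP => ?_
  exact ⟨V.X.presheaf.germ U P.1 (hcon P hP) g, Scheme.algebraMap_germ_eq_germToFunctionField V.X (hcon P hP) g⟩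

/-- Only finitely many prime divisors lie outside a given non-empty open subset. -/
theorem finite_primeDivisor_notMem {U : V.X.Opens} (hne : (U : Set V.X).Nonempty) :
    {P : V.PrimeDivisor | P.1 ∉ U}.Finite := by
  have : CompactSpace V.X := (quasiCompact_iff_compactSpace V.hom).1 inferInstance
  have : IsNoetherian V.X := { }
  obtain ⟨S, hS, hcl, hirr, hUS⟩ := NoetherianSpace.exists_finite_set_isClosed_irreducible
    U.2.isClosed_compl
  have hη : genericPoint V.X ∈ U := by
    obtain ⟨y, hy⟩ := hne
    exact (genericPoint_specializes y).mem_open U.2 hy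
  refine Set.Finite.of_finite_image (f := fun P : V.PrimeDivisor => closure {P.1}) (hS.subset ?_) ?_
  · rintro _ ⟨P, hP, rfl⟩
    obtain ⟨Z, hZS, hPZ⟩ : P.1 ∈ ⋃₀ S := hUS ▸ hP
    obtain ⟨z, hz⟩ := QuasiSober.sober (hirr Z hZS) (hcl Z hZS)
    have hzP : z ⤳ P.1 := hz.specializes hPZ
    have hzU : z ∈ (U : Set V.X)ᶜ := hUS ▸ ⟨Z, hZS, hz.mem⟩
    have hPz : P.1 ⤳ z := by
      -- If the generic point `z` of the component differed from that of `P`, the chain from `P`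
      -- through `z` to the generic point of `X` would give `P` codimension at least two.
      by_contra hnot
      have h1 : P.1 < z := ⟨hzP, hnot⟩
      have h2 : z < genericPoint V.X :=
        ⟨genericPoint_specializes z, fun h => hzU (h.mem_open U.2 hη)⟩
      have h3 := Order.coheight_add_one_le h1
      have h4 := Order.coheight_add_one_le h2
      rw [P.2] at h3
      have h5 : (1 : ℕ∞) + 1 ≤ 1 := calc
        (1 : ℕ∞) + 1 ≤ Order.coheight (genericPoint V.X) + 1 + 1 := by gcongr; simp
        _ ≤ Order.coheight z + 1 := by gcongr
        _ ≤ 1 := h3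
      exact absurd h5 (by decide)
    have : closure {P.1} = Z := by
      rw [(hPz.antisymm hzP).eq]
      exact hz.def
    change closure {P.1} ∈ S
    rwa [this]
  · intro P _ Q _ h
    exact Subtype.ext (Inseparable.eq (inseparable_iff_closure_eq.2 h))

/-- On a normal proper variety, a rational function without poles has no zeros. -/
theorem ordAlong_eq_zero_of_forall_nonneg (hn : V.IsNormal) [UniversallyClosed V.hom] {f : V.K}
    (hf : f ≠ 0) (h : ∀ P : V.PrimeDivisor, 0 ≤ ordAlong P f) (P : V.PrimeDivisor) :
    ordAlong P f = 0 := by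
  obtain ⟨g, rfl⟩ := exists_globalSection f fun x =>
    mem_range_stalk_of_forall_specializes hn x f fun P _ =>
      mem_range_stalk_of_ordAlong_nonneg hn P hf (h P)
  -- Global functions on an integral universally closed scheme over a field form a field.
  have hg : IsUnit g := by
    obtain ⟨g', hg'⟩ := (isField_of_universallyClosed k V.hom).mul_inv_cancel (a := g) (by
      rintro rfl
      exact hf (map_zero _))
    exact IsUnit.of_mul_eq_one g' hg'
  have : Nonempty (⊤ : V.X.Opens) := ⟨⟨P.1, trivial⟩⟩
  exact Scheme.ord_of_isUnit hg (U := ⊤) trivial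

/-! ### Multiplicities of Cartier divisors -/

/-- The multiplicity along a prime divisor as a homomorphism on Cartier divisors. -/
noncomputable def multHom (P : V.PrimeDivisor) : V.CaDiv →* Multiplicative ℤ :=
  (QuotientGroup.lift (V.stalkUnits P.1) (ordHom P) (stalkUnits_le_ker_ordHom P)).comp
    ((Pi.evalMonoidHom _ P.1).comp V.CaDiv.subtype)

theorem mult_eq (E : V.CaDiv) (P : V.PrimeDivisor) :
    CaDiv.mult E P = Multiplicative.toAdd (multHom P E) := rfl

theorem mult_mul (E F : V.CaDiv) (P : V.PrimeDivisor) :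
    CaDiv.mult (E * F) P = CaDiv.mult E P + CaDiv.mult F P := by
  simp [mult_eq]

theorem mult_zpow (E : V.CaDiv) (n : ℤ) (P : V.PrimeDivisor) :
    CaDiv.mult (E ^ n) P = n * CaDiv.mult E P := by
  simp [mult_eq]

theorem mult_principalCartier (f : V.Kˣ) (P : V.PrimeDivisor) :
    CaDiv.mult (principalCartier V f) P = ordAlong P (f : V.K) := rfl

theorem ordAlong_one (P : V.PrimeDivisor) : ordAlong P ((1 : V.Kˣ) : V.K) = 0 :=
  congrArg Multiplicative.toAdd (ordHom P).map_one

theorem ordAlong_mul (P : V.PrimeDivisor) (f g : V.Kˣ) :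
    ordAlong P ((f * g : V.Kˣ) : V.K) = ordAlong P (f : V.K) + ordAlong P (g : V.K) :=
  congrArg Multiplicative.toAdd ((ordHom P).map_mul f g)

theorem ordAlong_zpow (P : V.PrimeDivisor) (f : V.Kˣ) (n : ℤ) :
    ordAlong P ((f ^ n : V.Kˣ) : V.K) = n * ordAlong P (f : V.K) := by
  have := congrArg Multiplicative.toAdd ((ordHom P).map_zpow f n)
  rw [toAdd_zpow, smul_eq_mul] at this
  exact this

theorem ordAlong_inv (P : V.PrimeDivisor) (f : V.Kˣ) :
    ordAlong P ((f⁻¹ : V.Kˣ) : V.K) = - ordAlong P (f : V.K) :=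
  congrArg Multiplicative.toAdd ((ordHom P).map_inv f)

end Variety

/-! ### Projective space -/

section ProjectiveSpace

attribute [local instance] MvPolynomial.gradedAlgebra

variable (k : Type u) [Field k] (n : ℕ)

theorem algebraMap_homogeneousSubmodule_zero_surjective :
    Function.Surjective
      (algebraMap k (MvPolynomial.homogeneousSubmodule (Fin (n + 1)) k 0)) := by
  rintro ⟨p, hp⟩
  rw [MvPolynomial.homogeneousSubmodule_zero, Submodule.mem_one] at hp
  obtain ⟨c, hc⟩ := hp
  exact ⟨c, Subtype.ext hc⟩

theorem adjoin_range_X_homogeneousSubmodule_zero :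
    Algebra.adjoin (MvPolynomial.homogeneousSubmodule (Fin (n + 1)) k 0)
      (Set.range (MvPolynomial.X : Fin (n + 1) → MvPolynomial (Fin (n + 1)) k)) = ⊤ := by
  rw [eq_top_iff]
  rintro p -
  have hp : p ∈ Algebra.adjoin k
      (Set.range (MvPolynomial.X : Fin (n + 1) → MvPolynomial (Fin (n + 1)) k)) := by
    rw [MvPolynomial.adjoin_range_X]
    trivial
  induction hp using Algebra.adjoin_induction with
  | mem x hx => exact Algebra.subset_adjoin hx
  | algebraMap r =>
    exact Subalgebra.algebraMap_mem _
      (algebraMap k (MvPolynomial.homogeneousSubmodule (Fin (n + 1)) k 0) r)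
  | add x y _ _ hx hy => exact add_mem hx hy
  | mul x y _ _ hx hy => exact mul_mem hx hy

/-- `Proj` is proper over the spectrum of the degree-zero part when the ring is of finite type over
it, and the degree-zero part is a quotient of `k`. -/
theorem ProjSpace.isProper_hom : IsProper (ProjSpace.hom k n) := by
  have : IsClosedImmersion (Spec.map (CommRingCat.ofHom
      (algebraMap k (MvPolynomial.homogeneousSubmodule (Fin (n + 1)) k 0)))) :=
    IsClosedImmersion.spec_of_surjective _ (algebraMap_homogeneousSubmodule_zero_surjective k n)
  have : Algebra.FiniteType (MvPolynomial.homogeneousSubmodule (Fin (n + 1)) k 0)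
      (MvPolynomial (Fin (n + 1)) k) :=
    ⟨Subalgebra.fg_def.2 ⟨_, Set.finite_range _, adjoin_range_X_homogeneousSubmodule_zero k n⟩⟩
  have h₁ : IsProper (Proj.toSpecZero (MvPolynomial.homogeneousSubmodule (Fin (n + 1)) k)) :=
    inferInstance
  exact MorphismProperty.comp_mem @IsProper _ _ h₁ inferInstance

theorem ProjSpace.isAffineOpen_chart (b : Fin (n + 1)) :
    IsAffineOpen (ProjSpace.chart k n b) :=
  Proj.isAffineOpen_basicOpen _ _ (MvPolynomial.isHomogeneous_X k b) one_pos

theorem ProjSpace.exists_mem_chart (x : ProjSpace k n) : ∃ b, x ∈ ProjSpace.chart k n b := by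
  have h := Proj.iSup_basicOpen_eq_top' (MvPolynomial.homogeneousSubmodule (Fin (n + 1)) k)
    MvPolynomial.X (fun b => ⟨1, MvPolynomial.isHomogeneous_X k b⟩)
    (adjoin_range_X_homogeneousSubmodule_zero k n)
  have hx : x ∈ (⊤ : (Proj (MvPolynomial.homogeneousSubmodule (Fin (n + 1)) k)).Opens) := trivial
  rw [← h] at hx
  exact Opens.mem_iSup.1 hx

end ProjectiveSpace

/-! ### Very ample divisors and signs in the class group -/

namespace Variety

variable {k : Type u} [Field k] {V : Variety k}

theorem IsProjective.isProper (h : V.IsProjective) : IsProper V.hom := by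
  obtain ⟨n, i, hi, hcomp⟩ := h
  have := ProjSpace.isProper_hom k n
  rw [← hcomp]
  infer_instance

/-- A proper affine variety is a point, so all its Cartier divisors are principal. -/
theorem not_isAffine_of_nontrivial_CaCl [UniversallyClosed V.hom] [Nontrivial V.CaCl] :
    ¬ IsAffine V.X := by
  intro haff
  let _ : Field Γ(V.X, ⊤) := (isField_of_universallyClosed k V.hom).toField
  have : Subsingleton (Spec Γ(V.X, ⊤)) := inferInstanceAs (Subsingleton (PrimeSpectrum Γ(V.X, ⊤)))
  have : Subsingleton V.X := V.X.isoSpec.hom.homeomorph.injective.subsingleton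
  obtain ⟨c, hc⟩ := exists_ne (1 : V.CaCl)
  obtain ⟨E, rfl⟩ := QuotientGroup.mk_surjective c
  apply hc
  rw [QuotientGroup.eq_one_iff]
  obtain ⟨W, hW, f, hf⟩ := E.2 (genericPoint V.X)
  refine ⟨f, Subtype.ext (funext fun y => (hf y ?_).symm)⟩
  rwa [Subsingleton.elim y (genericPoint V.X)]

theorem ordAlong_eq_mult {E : V.CaDiv} {P : V.PrimeDivisor} {f : V.Kˣ}
    (h : E.1 P.1 = (f : V.Kˣ ⧸ V.stalkUnits P.1)) : ordAlong P (f : V.K) = CaDiv.mult E P := by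
  unfold CaDiv.mult
  rw [h]
  rfl

/-- On a normal variety, a global section with empty zero divisor generates the sheaf of the
divisor everywhere. -/
theorem generatesAt_of_forall_eq_zero (hn : V.IsNormal) {D : V.QDiv} {s : V.Kˣ}
    (hs : ∀ P : V.PrimeDivisor, (ordAlong P (s : V.K) : ℚ) + D P = 0) (x : V.X) :
    QDiv.GeneratesAt D s x := by
  refine ⟨⟨⊤, trivial, fun _ P _ => (hs P).ge⟩, ?_⟩
  rintro g ⟨W, hxW, hg⟩
  by_cases hg0 : g = 0
  · exact ⟨0, by rw [hg0, map_zero, zero_mul]⟩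
  obtain ⟨a, ha⟩ := mem_range_stalk_of_forall_specializes hn x
    ((Units.mk0 g hg0 * s⁻¹ : V.Kˣ) : V.K) fun P hP => by
      refine mem_range_stalk_of_ordAlong_nonneg hn P (Units.ne_zero _) ?_
      have h1 := hg hg0 P (hP.mem_open W.2 hxW)
      have h2 := hs P
      rw [ordAlong_mul, ordAlong_inv, Units.val_mk0]
      have h3 : (ordAlong P (s : V.K) : ℚ) ≤ ordAlong P g := by linarith
      have h4 : ordAlong P (s : V.K) ≤ ordAlong P g := by exact_mod_cast h3
      linarith
  refine ⟨a, ?_⟩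
  rw [ha, Units.val_mul, Units.val_mk0, mul_assoc, Units.inv_mul, mul_one]

/-- A very ample divisor on a normal proper variety that is not affine is linearly equivalent to a
nonzero effective divisor. -/
theorem QDiv.IsVeryAmple.exists_section (hn : V.IsNormal) [IsProper V.hom] (haff : ¬ IsAffine V.X)
    {D : V.QDiv} (hD : QDiv.IsVeryAmple D) :
    ∃ s : V.Kˣ, (∀ P : V.PrimeDivisor, 0 ≤ (ordAlong P (s : V.K) : ℚ) + D P) ∧
      ∃ P : V.PrimeDivisor, (ordAlong P (s : V.K) : ℚ) + D P ≠ 0 := by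
  obtain ⟨⟨E, hE⟩, n, s, i, hi, hs⟩ := hD
  obtain ⟨a, ha⟩ := ProjSpace.exists_mem_chart k n (i (genericPoint V.X))
  -- At the generic point `s a` generates the stalk, which contains the inverse of a local equation
  -- of `D`.
  have hsa : s a ≠ 0 := by
    intro h0
    obtain ⟨W, hW, f, hf⟩ := E.2 (genericPoint V.X)
    obtain ⟨t, ht⟩ := ((hs.locus a _).1 ha).2 ((f⁻¹ : V.Kˣ) : V.K) ⟨W, hW, fun _ P hP => by
      rw [ordAlong_inv, ordAlong_eq_mult (hf P.1 hP), hE]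
      push_cast
      simp⟩
    rw [h0, mul_zero] at ht
    exact Units.ne_zero _ ht
  refine ⟨Units.mk0 (s a) hsa, fun P => hs.global a hsa P trivial, ?_⟩
  by_contra! hcon
  -- A section without zeros generates everywhere, so all of `X` maps into one affine chart. A
  -- proper immersion is closed, hence affine, and `X` would be affine.
  have htop : i ⁻¹ᵁ ProjSpace.chart k n a = ⊤ := by
    rw [eq_top_iff]
    intro x _
    exact (hs.locus a x).2 (generatesAt_of_forall_eq_zero hn hcon x)
  have := ProjSpace.isProper_hom k n
  have hprop : IsProper (i ≫ ProjSpace.hom k n) := by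
    rw [hs.comp_hom]
    infer_instance
  have : IsProper i := IsProper.of_comp i (ProjSpace.hom k n)
  have : IsClosedImmersion i := (IsClosedImmersion.iff_isProper_and_mono i).2 ⟨this, inferInstance⟩
  have haff' := (ProjSpace.isAffineOpen_chart k n a).preimage i
  rw [htop] at haff'
  have : IsAffine (⊤ : V.X.Opens) := haff'
  exact haff (IsAffine.of_isIso V.X.topIso.inv)

theorem IsCylinder.isAffineOpen {U : V.X.Opens} (hU : IsCylinder U) : IsAffineOpen U := by
  obtain ⟨-, C, g, hC, e, -⟩ := hU
  exact IsAffine.of_isIso e.hom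

/-- If `CaCl(X)` is infinite cyclic, a relation between the classes of two Cartier divisors is
witnessed by a rational function. -/
theorem exists_ordAlong_eq (φ : V.CaCl ≃* Multiplicative ℤ) (A E : V.CaDiv) (p q : ℤ)
    (h : p * Multiplicative.toAdd (φ A) + q * Multiplicative.toAdd (φ E) = 0) :
    ∃ f : V.Kˣ, ∀ P : V.PrimeDivisor,
      ordAlong P (f : V.K) = p * CaDiv.mult A P + q * CaDiv.mult E P := by
  have h1 : ((A ^ p * E ^ q : V.CaDiv) : V.CaCl) = 1 := by
    apply φ.injective
    apply Multiplicative.toAdd.injective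
    rw [QuotientGroup.mk_mul, QuotientGroup.mk_zpow, QuotientGroup.mk_zpow, map_mul, map_zpow,
      map_zpow, map_one, toAdd_mul, toAdd_zpow, toAdd_zpow, smul_eq_mul, smul_eq_mul, h, toAdd_one]
  rw [QuotientGroup.eq_one_iff] at h1
  obtain ⟨f, hf⟩ := h1
  refine ⟨f, fun P => ?_⟩
  rw [← mult_principalCartier, hf, mult_mul, mult_zpow, mult_zpow]

/-- The classes in `CaCl(X) ≅ ℤ` of two Cartier divisors that are linearly equivalent to nonzero
effective ones have the same sign. -/
theorem toAdd_mul_toAdd_pos (hn : V.IsNormal) [UniversallyClosed V.hom]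
    (φ : V.CaCl ≃* Multiplicative ℤ) {A E : V.CaDiv} {s t : V.Kˣ}
    (hA : ∀ P : V.PrimeDivisor, 0 ≤ ordAlong P (s : V.K) + CaDiv.mult A P)
    (hA' : ∃ P : V.PrimeDivisor, ordAlong P (s : V.K) + CaDiv.mult A P ≠ 0)
    (hE : ∀ P : V.PrimeDivisor, 0 ≤ ordAlong P (t : V.K) + CaDiv.mult E P)
    (hE' : ∃ P : V.PrimeDivisor, ordAlong P (t : V.K) + CaDiv.mult E P ≠ 0) :
    0 < Multiplicative.toAdd (φ A) * Multiplicative.toAdd (φ E) := by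
  -- For such a relation, the function `f * s ^ p * t ^ q` has as divisor the combination of the two
  -- effective divisors. It has no poles, so this divisor is zero, and both nonnegative summands
  -- vanish.
  have key : ∀ p q : ℤ, 0 ≤ p → 0 ≤ q →
      p * Multiplicative.toAdd (φ A) + q * Multiplicative.toAdd (φ E) = 0 → p = 0 ∧ q = 0 := by
    intro p q hp hq h
    obtain ⟨f, hf⟩ := exists_ordAlong_eq φ A E p q h
    have hord : ∀ P : V.PrimeDivisor, ordAlong P ((f * s ^ p * t ^ q : V.Kˣ) : V.K) =
        p * (ordAlong P (s : V.K) + CaDiv.mult A P) +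
          q * (ordAlong P (t : V.K) + CaDiv.mult E P) := by
      intro P
      rw [ordAlong_mul, ordAlong_mul, ordAlong_zpow, ordAlong_zpow, hf]
      ring
    have hzero : ∀ P : V.PrimeDivisor, p * (ordAlong P (s : V.K) + CaDiv.mult A P) +
        q * (ordAlong P (t : V.K) + CaDiv.mult E P) = 0 := by
      intro P
      rw [← hord]
      refine ordAlong_eq_zero_of_forall_nonneg hn (Units.ne_zero _) (fun Q => ?_) P
      rw [hord]
      have := mul_nonneg hp (hA Q)
      have := mul_nonneg hq (hE Q)
      linarith
    have hz : ∀ P : V.PrimeDivisor, p * (ordAlong P (s : V.K) + CaDiv.mult A P) = 0 ∧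
        q * (ordAlong P (t : V.K) + CaDiv.mult E P) = 0 := fun P =>
      (add_eq_zero_iff_of_nonneg (mul_nonneg hp (hA P)) (mul_nonneg hq (hE P))).1 (hzero P)
    obtain ⟨P, hP⟩ := hA'
    obtain ⟨Q, hQ⟩ := hE'
    exact ⟨(mul_eq_zero.1 (hz P).1).resolve_right hP, (mul_eq_zero.1 (hz Q).2).resolve_right hQ⟩
  by_contra! hle
  set a := Multiplicative.toAdd (φ A)
  set e := Multiplicative.toAdd (φ E)
  -- With opposite signs the two terms cancel; with equal signs, $ae \le 0$ forces $ae = 0$. Then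
  -- `key` gives $a = 0$, after which the pair $(1, 0)$ is a forbidden relation.
  have h0 : |e| * a + |a| * e = 0 := by
    rcases le_total 0 a with ha | ha <;> rcases le_total 0 e with he | he
    · rw [abs_of_nonneg ha, abs_of_nonneg he]
      nlinarith [mul_nonneg ha he]
    · rw [abs_of_nonneg ha, abs_of_nonpos he]
      ring
    · rw [abs_of_nonpos ha, abs_of_nonneg he]
      ring
    · rw [abs_of_nonpos ha, abs_of_nonpos he]
      nlinarith [mul_nonneg_of_nonpos_of_nonpos ha he]
  have h1 := (key |e| |a| (abs_nonneg _) (abs_nonneg _) h0).2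
  have h2 := (key 1 0 zero_le_one le_rfl (by rw [abs_eq_zero.1 h1]; ring)).1
  exact one_ne_zero h2

/-- The reduced divisor of the prime divisors outside a non-empty open subset. -/
theorem exists_boundary {U : V.X.Opens} (hne : (U : Set V.X).Nonempty) :
    ∃ E : V.Div, (∀ P : V.PrimeDivisor, 0 ≤ E P) ∧ ∀ P : V.PrimeDivisor, E P ≠ 0 ↔ P.1 ∉ U := by
  classical
  let E : V.Div := Finsupp.ofSupportFinite (fun P => if P.1 ∈ U then 0 else 1)
    ((finite_primeDivisor_notMem hne).subset fun P hP h => hP (if_pos h))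
  have hE : ∀ P : V.PrimeDivisor, E P = if P.1 ∈ U then 0 else 1 := fun _ => rfl
  refine ⟨E, fun P => ?_, fun P => ?_⟩ <;> rw [hE] <;> split_ifs with h <;> simp [h]

/-- Purity of the complement puts every point outside `U` on a prime divisor outside `U`. -/
theorem supp_eq_compl (hn : V.IsNormal) {U : V.X.Opens} (hU : IsAffineOpen U)
    (hne : (U : Set V.X).Nonempty) {D : V.QDiv}
    (hD : ∀ P : V.PrimeDivisor, D P ≠ 0 ↔ P.1 ∉ U) : QDiv.supp D = (U : Set V.X)ᶜ := by
  ext x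
  simp only [QDiv.supp, Set.mem_iUnion, Set.mem_ofPred_eq, Set.mem_compl_iff, exists_prop]
  constructor
  · rintro ⟨P, hP, hx⟩ hxU
    exact (hD P).1 hP ((specializes_iff_mem_closure.2 hx).mem_open U.2 hxU)
  · intro hx
    obtain ⟨P, hPx, hPU⟩ := exists_primeDivisor_of_notMem hn hU hne hx
    exact ⟨P, (hD P).2 hPU, hPx.mem_closure⟩

end Variety

end PolarCyl

/-! ### Scaling the boundary divisor to the class of $H$ -/

theorem mainTheorem10 (k : Type u) [Field k] [IsAlgClosed k] [CharZero k]
    (V : PolarCyl.Variety k) (hnormal : V.IsNormal) (hproj : V.IsProjective)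
    (hfact : V.IsQFactorial) (hCaCl : Nonempty (V.CaCl ≃* Multiplicative ℤ))
    (H : V.QDiv) (hH : H.IsAmple) (U : V.X.Opens) (hU : PolarCyl.Variety.IsCylinder U) :
    PolarCyl.Variety.IsPolar H U := by
  refine ⟨hU, ?_⟩
  have hne := hU.1
  have haffU := PolarCyl.Variety.IsCylinder.isAffineOpen hU
  have := PolarCyl.Variety.IsProjective.isProper hproj
  obtain ⟨φ⟩ := hCaCl
  have : Nontrivial V.CaCl := φ.toEquiv.nontrivial
  have hnaff := PolarCyl.Variety.not_isAffine_of_nontrivial_CaCl (V := V)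
  obtain ⟨m, hm, hvery⟩ := hH
  obtain ⟨A, hA⟩ := hvery.1
  obtain ⟨s, hs, P₀, hP₀⟩ := hvery.exists_section hnormal hnaff
  obtain ⟨B, hB, hBU⟩ := PolarCyl.Variety.exists_boundary hne
  obtain ⟨n, hn, E, hE⟩ := hfact B
  have hA' : ∀ P, (m : ℚ) * H P = (PolarCyl.Variety.CaDiv.mult A P : ℚ) := fun P => by
    rw [← hA, Finsupp.smul_apply, nsmul_eq_mul]
  have hE' : ∀ P, PolarCyl.Variety.CaDiv.mult E P = n * B P := fun P => by
    have := hE P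
    rw [Finsupp.smul_apply, nsmul_eq_mul, PolarCyl.Variety.Div.toQDiv,
      Finsupp.mapRange_apply] at this
    exact_mod_cast this.symm
  have hUtop : ∃ x, x ∉ U := by
    by_contra! h
    have hU' : U = ⊤ := eq_top_iff.2 fun x _ => h x
    subst hU'
    have : IsAffine (⊤ : V.X.Opens) := haffU
    exact hnaff (IsAffine.of_isIso V.X.topIso.inv)
  obtain ⟨x, hx⟩ := hUtop
  obtain ⟨P₁, -, hP₁⟩ := PolarCyl.Variety.exists_primeDivisor_of_notMem hnormal haffU hne hx
  -- `E` is itself effective, so the constant function `t = 1` serves; it is nonzero because `U`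
  -- misses some prime divisor.
  have hpos := PolarCyl.Variety.toAdd_mul_toAdd_pos hnormal φ (A := A) (E := E) (s := s) (t := 1)
    (fun P => by
      have := hs P
      rw [hA] at this
      exact_mod_cast this)
    ⟨P₀, fun h => hP₀ (by rw [hA]; exact_mod_cast h)⟩
    (fun P => by
      rw [PolarCyl.Variety.ordAlong_one, hE', zero_add]
      exact mul_nonneg (by positivity) (hB P))
    ⟨P₁, by
      rw [PolarCyl.Variety.ordAlong_one, hE', zero_add]
      exact mul_ne_zero (by exact_mod_cast hn.ne') ((hBU P₁).2 hP₁)⟩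
  set a := Multiplicative.toAdd (φ A)
  set e := Multiplicative.toAdd (φ E)
  have ha : a ≠ 0 := left_ne_zero_of_mul hpos.ne'
  have he : e ≠ 0 := right_ne_zero_of_mul hpos.ne'
  have hrel : |e| * a + (-|a|) * e = 0 := by
    rcases pos_and_pos_or_neg_and_neg_of_mul_pos hpos with ⟨h1, h2⟩ | ⟨h1, h2⟩
    · rw [abs_of_pos h1, abs_of_pos h2]
      ring
    · rw [abs_of_neg h1, abs_of_neg h2]
      ring
  obtain ⟨f, hf⟩ := PolarCyl.Variety.exists_ordAlong_eq φ A E _ _ hrel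
  have hm0 : (m : ℚ) ≠ 0 := by exact_mod_cast hm.ne'
  have hn0 : (n : ℚ) ≠ 0 := by exact_mod_cast hn.ne'
  have hnat : ∀ z : ℤ, ((z.natAbs : ℕ) : ℚ) = ((|z| : ℤ) : ℚ) := fun z => by
    rw [← Int.natCast_natAbs, Int.cast_natCast]
  have ha0 : ((|a| : ℤ) : ℚ) ≠ 0 := by exact_mod_cast (abs_pos.2 ha).ne'
  have he0 : ((|e| : ℤ) : ℚ) ≠ 0 := by exact_mod_cast (abs_pos.2 he).ne'
  have hc : (((|a| : ℤ) : ℚ) * n) / (((|e| : ℤ) : ℚ) * m) ≠ 0 := by positivity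
  -- The coefficient solves $|e|m\,D = |a|n\,B = |a|E$, to be compared with $|e|m\,H = |e|A$.
  let D : V.QDiv :=
    ((((|a| : ℤ) : ℚ) * n) / (((|e| : ℤ) : ℚ) * m)) • PolarCyl.Variety.Div.toQDiv B
  have hDapp : ∀ P, D P = ((((|a| : ℤ) : ℚ) * n) / (((|e| : ℤ) : ℚ) * m)) * (B P : ℚ) :=
    fun P => rfl
  have hND : ∀ P, ((e.natAbs * m) • D) P = ((|a| * PolarCyl.Variety.CaDiv.mult E P : ℤ) : ℚ) := fun P => by
    rw [Finsupp.smul_apply, nsmul_eq_mul, hDapp, hE']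
    push_cast [hnat]
    push_cast at he0
    field_simp
  have hNpos : 0 < e.natAbs * m := Nat.mul_pos (Int.natAbs_pos.2 he) hm
  -- The multiple $|e|m$ serves both for $\mathbb{Q}$-Cartier and for $\mathbb{Q}$-linear
  -- equivalence. The function is inverted since `f` has divisor $|e|A - |a|E$, the negative of
  -- $|e|m(D - H)$.
  refine ⟨D, fun P => ?_, ⟨_, hNpos, E ^ |a|, fun P => ?_⟩, ⟨_, hNpos, f⁻¹, fun P => ?_⟩, ?_⟩
  · rw [hDapp]
    have : (0 : ℚ) ≤ (B P : ℚ) := by exact_mod_cast hB P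
    positivity
  · rw [hND, PolarCyl.Variety.mult_zpow]
  · rw [Finsupp.sub_apply, hND, PolarCyl.Variety.ordAlong_inv, hf, Finsupp.smul_apply,
      nsmul_eq_mul]
    push_cast [hnat]
    rw [← hA']
    ring
  · rw [PolarCyl.Variety.supp_eq_compl hnormal haffU hne fun P => ?_, compl_compl]
    rw [← hBU, hDapp, Ne, mul_eq_zero, not_or, Int.cast_eq_zero]
    exact and_iff_right hc
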